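/- \textbf{Setting.} In an election with ordered ballots, each voter of a finite set of voters hands in a list of distinct candidates in order of preference. Votes are real-valued: each voter counts with a positive real weight, and numbers of votes or voters are total weights (ordinary elections are those where all weights equal $1$). In \emph{Thiele's ordered method} the seats are distributed one at a time. In each round each ballot is counted only for the first name on it that is not already elected, with weight $1/k$ (times the weight of the voter) if this is name number $k$ on the ballot. The \emph{score} of a candidate in the round is the sum of these contributions, and a not yet elected candidate with the largest score is elected (ties may be broken in any way). A candidate is \emph{elected with score at least $t$} if she is elected and her score in the round where she is elected is at least $t$. For $n\ge1$, let $a_n$ be the smallest total number of votes in an election by Thiele's ordered method in which there are exactly $n$ candidates and each of them is elected with score at least $1$. Let $b_n$, $n\ge1$, be defined by the recursion $$b_n=1-\sum_{i=1}^{n-1}\frac{b_i}{n+1-i},\qquad n\ge1,$$ or, equivalently, by $$\sum_{i=1}^{n}\frac{b_i}{n+1-i}=1,\qquad n\ge1.$$ \textbf{Lemma.} (i) Consider an election by Thiele's ordered method with $n\ge1$ candidates $A_1,\dots,A_n$, and perhaps others, in which each $A_i$ is elected with score at least $t\ge0$. Let $W$ be the number of voters that have voted for at least one of $A_1,\dots,A_n$.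 Then $W\ge a_n t$. (ii) The minimum defining $a_n$ is attained, and for every $n\ge1$ $$a_n=\sum_{i=1}^n b_i .$$ Furthermore, with $a_0=b_0=0$, the Taylor series at $0$ $$\sum_{n\ge0} a_nz^n=\frac{z^2}{-(1-z)^2\log(1-z)},\qquad \sum_{n\ge0} b_nz^n=\frac{z^2}{-(1-z)\log(1-z)}$$ converge and hold for $|z|<1$ (the right-hand sides being $0$ at $z=0$), and, as $n\to\infty$, $$a_n\sim\frac{n}{\log n},\qquad b_n\sim\frac1{\log n}.$$ (iii) The numbers $b_n$, $n\ge1$, are strictly decreasing and satisfy $0<b_n\le1$. -/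

import Mathlib

universe u v

/-- An election with ordered ballots and real-valued votes: each voter `v` (of the voter set `V`)
hands in a list of distinct candidates, in order of preference, and counts with a positive real
weight. (Ordinary elections are those in which every weight is `1`.) -/
structure OrderedElection (V C : Type*) where
  /-- the ballot of each voter -/
  ballot : V → List C
  /-- the names on a ballot are distinct -/
  nodup : ∀ v, (ballot v).Nodup
  /-- the number of votes that the voter counts for -/
  weight : V → ℝ
  weight_pos : ∀ v, 0 < weight v

namespace OrderedElection

variable {V C : Type*} [Fintype V] [DecidableEq C]

/-- The total number of votes. -/
noncomputable def totalVotes (P : OrderedElection V C) : ℝ := ∑ v, P.weight v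

/-- The number of voters (by weight) that have voted for at least one candidate in `A`. -/
noncomputable def votersFor (P : OrderedElection V C) (A : Finset C) : ℝ :=
  ∑ v with ∃ c ∈ A, c ∈ P.ballot v, P.weight v

/-- The score of the candidate `c` in Thiele's ordered method in a round where the set of already
elected candidates is `E`. Each ballot is counted only for the first name on it that is not in
`E`, with weight `1 / k` if this is name number `k` on the ballot (`List.idxOf` counts
from `0`, so `k = idxOf + 1`). -/
noncomputable def score (P : OrderedElection V C) (E : Finset C) (c : C) : ℝ :=
  ∑ v, if (P.ballot v).find? (fun d => d ∉ E) = some c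
    then P.weight v * (1 / (((P.ballot v).idxOf c : ℝ) + 1)) else 0

/-- The candidates elected before round `r`, if the candidates are elected in the order `e`. -/
def electedBefore {S : ℕ} (e : Fin S → C) (r : Fin S) : Finset C :=
  (Finset.univ.filter (fun s => s < r)).image e

/-- `e 0, e 1, …, e (S - 1)` is a possible order of election of `S` candidates by Thiele's ordered
method: in each round, a not yet elected candidate with the largest score among all candidates not
yet elected is elected (ties are broken arbitrarily). -/
def IsThieleOrder (P : OrderedElection V C) {S : ℕ} (e : Fin S → C) : Prop :=
  ∀ r : Fin S, e r ∉ electedBefore e r ∧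
    ∀ c : C, c ∉ electedBefore e r →
      P.score (electedBefore e r) c ≤ P.score (electedBefore e r) (e r)

/-- If the candidates are elected in the order `e`, then `c` is elected, and its score in the round
where it is elected is at least `t`. -/
def ElectedWithScoreAtLeast (P : OrderedElection V C) {S : ℕ} (e : Fin S → C) (t : ℝ) (c : C) :
    Prop :=
  ∃ r : Fin S, e r = c ∧ t ≤ P.score (electedBefore e r) c

end OrderedElection

/-- The set of all total numbers of votes in elections by Thiele's ordered method with exactly `n`
candidates, each of which is elected with score at least `1`. -/
def thieleVoteTotals (n : ℕ) : Set ℝ :=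
  {x | ∃ (N : ℕ) (P : OrderedElection (Fin N) (Fin n)) (S : ℕ) (e : Fin S → Fin n),
    P.IsThieleOrder e ∧ (∀ c : Fin n, P.ElectedWithScoreAtLeast e 1 c) ∧ x = P.totalVotes}

/-- `a n`, the smallest total number of votes in an election by Thiele's ordered method with exactly
`n` candidates, each of which is elected with score at least `1`. -/
noncomputable def thieleA (n : ℕ) : ℝ := sInf (thieleVoteTotals n)

/-- The sequence `b n` with `b n = 1 - ∑_{i=1}^{n-1} b i / (n + 1 - i)` for `n ≥ 1`
(and `b 0 = 0`); here `n` is written `n + 1` and the summation index `i` is written `i + 1`. -/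
noncomputable def thieleB : ℕ → ℝ
  | 0 => 0
  | n + 1 => 1 - ∑ i : Fin n, thieleB (i.val + 1) / ((n : ℝ) + 1 - (i.val : ℝ))
decreasing_by exact Nat.succ_lt_succ i.isLt

/-! Everything about `b` rests on the identity `b_{n+1} = ∫₀¹ p_n(x) dx` with `p_n = fallingProd n`.
The generating function of the `p_n(x)` is `(1 - z)^(x - 1)`; differentiating in `x` multiplies it
by `log (1 - z)`, so integrating over `[0, 1]` shows that the integrals satisfy the convolution
defining `b` (`thieleB_succ_eq_integral`). On `(0, 1)` the `p_n` are positive and decrease in `n`,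
hence so does `b`.

The formula for `a_n` is linear programming duality. For the lower bound, a candidate of `A` gets
the dual price `b_j` if `j` members of `A` are elected from her round on; since `b` decreases, the
convolution bounds by `1` what each ballot pays (`sum_thieleB_div_le_one`). In the election
`extremal` the same convolution makes every winning score exactly `1`, so the bound is attained.

For the asymptotics, `tailProd n x` is compared with powers `n^(-x)`, up to constants, and
integrated. This bounds `b_n` from below and `a_n / n` from above; `b_n ≤ a_n / n` then settles
both. The Taylor series are Cauchy products. -/

section

open Finset

/-! ### Integral representation of `b` -/

/-- The polynomial `∏_{k=1}^n (1 - x / k)`. -/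
noncomputable def fallingProd (n : ℕ) (x : ℝ) : ℝ := ∏ k ∈ range n, (1 - x / ((k : ℝ) + 1))

theorem fallingProd_zero (x : ℝ) : fallingProd 0 x = 1 := by simp [fallingProd]

theorem fallingProd_succ (n : ℕ) (x : ℝ) :
    fallingProd (n + 1) x = fallingProd n x * (1 - x / ((n : ℝ) + 1)) := by
  simp [fallingProd, prod_range_succ]

theorem continuous_fallingProd (n : ℕ) : Continuous (fallingProd n) := by
  unfold fallingProd
  fun_prop

theorem fallingProd_at_zero (n : ℕ) : fallingProd n 0 = 1 := by simp [fallingProd]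

theorem fallingProd_succ_at_one (n : ℕ) : fallingProd (n + 1) 1 = 0 := by
  simp [fallingProd, prod_range_succ']

theorem one_sub_div_succ_pos {x : ℝ} (hx : x < 1) (k : ℕ) : 0 < 1 - x / ((k : ℝ) + 1) := by
  have hk : (0 : ℝ) ≤ k := k.cast_nonneg
  rw [sub_pos, div_lt_one (by linarith)]
  linarith

theorem fallingProd_pos {x : ℝ} (hx : x < 1) (n : ℕ) : 0 < fallingProd n x :=
  prod_pos fun k _ => one_sub_div_succ_pos hx k

theorem fallingProd_succ_lt {x : ℝ} (hx0 : 0 < x) (hx : x < 1) (n : ℕ) :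
    fallingProd (n + 1) x < fallingProd n x := by
  rw [fallingProd_succ]
  have h : 0 < x / ((n : ℝ) + 1) := by positivity
  nlinarith [fallingProd_pos hx n]

/-- The sum on the right is the coefficient of `z ^ n` in `-log (1 - z) * (1 - z) ^ (x - 1)`. -/
theorem hasDerivAt_fallingProd (n : ℕ) (x : ℝ) :
    HasDerivAt (fallingProd n) (-∑ i ∈ range n, fallingProd i x / ((n : ℝ) - i)) x := by
  induction n with
  | zero =>
    have : fallingProd 0 = fun _ => (1 : ℝ) := funext fallingProd_zero
    simpa [this] using hasDerivAt_const x (1 : ℝ)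
  | succ n ih =>
    have h1 : HasDerivAt (fun y : ℝ => 1 - y / ((n : ℝ) + 1)) (-(1 / ((n : ℝ) + 1))) x :=
      ((hasDerivAt_id x).div_const _).const_sub 1
    have h2 := ih.mul h1
    have h3 : fallingProd (n + 1) = fallingProd n * fun y : ℝ => 1 - y / ((n : ℝ) + 1) :=
      funext (fallingProd_succ n)
    rw [h3]
    refine h2.congr_deriv ?_
    have hn : (n : ℝ) + 1 ≠ 0 := by positivity
    -- Uses `1 - x/(n+1) = (n-i)/(n+1) + (i+1)/(n+1) * (1 - x/(i+1))`, whose last factor turns `p_i`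
    -- into `p_{i+1}`.
    have e1 : ∀ i ∈ range n, fallingProd i x / ((n : ℝ) - i) * (1 - x / ((n : ℝ) + 1)) =
        fallingProd i x / ((n : ℝ) + 1) +
          ((i + 1 : ℕ) : ℝ) / (((n : ℝ) + 1) * ((n : ℝ) + 1 - (i + 1 : ℕ))) *
            fallingProd (i + 1) x := by
      intro i hi
      have hi' : (i : ℝ) < n := by exact_mod_cast mem_range.1 hi
      have h4 : (n : ℝ) - i ≠ 0 := by linarith
      have h6 : (n : ℝ) + 1 - ((i : ℝ) + 1) ≠ 0 := by intro h; apply h4; linarith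
      have h5 : (i : ℝ) + 1 ≠ 0 := by positivity
      rw [fallingProd_succ]
      push_cast
      rw [show (n : ℝ) + 1 - ((i : ℝ) + 1) = n - i by ring]
      field_simp
      ring
    have e2 : ∑ i ∈ range n, ((i + 1 : ℕ) : ℝ) / (((n : ℝ) + 1) * ((n : ℝ) + 1 - (i + 1 : ℕ))) *
            fallingProd (i + 1) x =
        ∑ i ∈ range (n + 1), (i : ℝ) / (((n : ℝ) + 1) * ((n : ℝ) + 1 - i)) * fallingProd i x := by
      rw [sum_range_succ']
      simp
    have e3 : ∑ i ∈ range (n + 1), fallingProd i x / (((n + 1 : ℕ) : ℝ) - i) =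
        ∑ i ∈ range (n + 1), fallingProd i x / ((n : ℝ) + 1) +
        ∑ i ∈ range (n + 1), (i : ℝ) / (((n : ℝ) + 1) * ((n : ℝ) + 1 - i)) * fallingProd i x := by
      rw [← sum_add_distrib]
      refine sum_congr rfl fun i hi => ?_
      have hi' : (i : ℝ) < n + 1 := by exact_mod_cast mem_range.1 hi
      have h4 : (n : ℝ) + 1 - i ≠ 0 := by linarith
      push_cast
      field_simp
      ring
    rw [e3, neg_mul, sum_mul, sum_congr rfl e1, sum_add_distrib, e2,
      sum_range_succ fun i => fallingProd i x / ((n : ℝ) + 1)]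
    ring

/-- Integrate the derivative of `p_{n+1}`, which falls from `1` at `0` to `0` at `1`. -/
theorem integral_fallingProd_convolution (n : ℕ) :
    ∑ i ∈ range (n + 1), (∫ x in (0 : ℝ)..1, fallingProd i x) / (((n : ℝ) + 1) - i) = 1 := by
  have h := intervalIntegral.integral_eq_sub_of_hasDerivAt (a := (0 : ℝ)) (b := 1)
    (fun x _ => hasDerivAt_fallingProd (n + 1) x)
    (Continuous.intervalIntegrable (by
      have := continuous_fallingProd
      fun_prop) _ _)
  rw [fallingProd_succ_at_one, fallingProd_at_zero, intervalIntegral.integral_neg,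
    intervalIntegral.integral_finsetSum (fun i _ =>
      ((continuous_fallingProd i).div_const _).intervalIntegrable _ _)] at h
  simp only [intervalIntegral.integral_div] at h
  push_cast at h
  linarith

theorem sum_Icc_one_eq_sum_range (f : ℕ → ℝ) (n : ℕ) :
    ∑ i ∈ Icc 1 n, f i = ∑ i ∈ range n, f (i + 1) := by
  rw [range_eq_Ico, sum_Ico_add' f 0 n 1]
  rfl

theorem recursion_iff_convolution (b : ℕ → ℝ) {n : ℕ} (hn : 1 ≤ n) :
    b n = 1 - ∑ i ∈ Icc 1 (n - 1), b i / ((n : ℝ) + 1 - (i : ℝ)) ↔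
      ∑ i ∈ Icc 1 n, b i / ((n : ℝ) + 1 - (i : ℝ)) = 1 := by
  obtain ⟨m, rfl⟩ : ∃ m, n = m + 1 := ⟨n - 1, by omega⟩
  rw [sum_Icc_succ_top (by omega), Nat.add_sub_cancel]
  simp only [add_sub_cancel_left, div_one]
  constructor <;> intro h <;> linarith

theorem thieleB_recursion {n : ℕ} (hn : 1 ≤ n) :
    thieleB n = 1 - ∑ i ∈ Icc 1 (n - 1), thieleB i / ((n : ℝ) + 1 - (i : ℝ)) := by
  obtain ⟨m, rfl⟩ : ∃ m, n = m + 1 := ⟨n - 1, by omega⟩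
  rw [thieleB, Nat.add_sub_cancel, sum_Icc_one_eq_sum_range, Finset.sum_range]
  congr 1
  refine sum_congr rfl fun i _ => ?_
  push_cast
  congr 1
  ring

theorem thieleB_convolution {n : ℕ} (hn : 1 ≤ n) :
    ∑ i ∈ Icc 1 n, thieleB i / ((n : ℝ) + 1 - (i : ℝ)) = 1 :=
  (recursion_iff_convolution thieleB hn).1 (thieleB_recursion hn)

/-- Both sequences satisfy the same convolution, which determines each term from the earlier ones.
-/
theorem thieleB_succ_eq_integral (n : ℕ) :
    thieleB (n + 1) = ∫ x in (0 : ℝ)..1, fallingProd n x := by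
  induction n using Nat.strong_induction_on with
  | _ n ih =>
    have h1 := thieleB_convolution (n := n + 1) (by omega)
    have h2 := integral_fallingProd_convolution n
    rw [sum_Icc_one_eq_sum_range, sum_range_succ] at h1
    rw [sum_range_succ] at h2
    have h3 : ∑ i ∈ range n, thieleB (i + 1) / (((n + 1 : ℕ) : ℝ) + 1 - ((i + 1 : ℕ) : ℝ)) =
        ∑ i ∈ range n, (∫ x in (0 : ℝ)..1, fallingProd i x) / (((n : ℝ) + 1) - i) := by
      refine sum_congr rfl fun i hi => ?_
      rw [ih i (mem_range.1 hi)]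
      push_cast
      congr 1
      ring
    rw [h3] at h1
    simp only [add_sub_cancel_left, div_one] at h1 h2
    linarith

theorem thieleB_pos {n : ℕ} (hn : 1 ≤ n) : 0 < thieleB n := by
  obtain ⟨m, rfl⟩ : ∃ m, n = m + 1 := ⟨n - 1, by omega⟩
  rw [thieleB_succ_eq_integral]
  exact intervalIntegral.intervalIntegral_pos_of_pos_on
    ((continuous_fallingProd m).intervalIntegrable _ _)
    (fun x hx => fallingProd_pos hx.2 m) one_pos

theorem thieleB_succ_lt {n : ℕ} (hn : 1 ≤ n) : thieleB (n + 1) < thieleB n := by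
  obtain ⟨m, rfl⟩ : ∃ m, n = m + 1 := ⟨n - 1, by omega⟩
  rw [thieleB_succ_eq_integral, thieleB_succ_eq_integral, ← sub_pos,
    ← intervalIntegral.integral_sub ((continuous_fallingProd _).intervalIntegrable _ _)
      ((continuous_fallingProd _).intervalIntegrable _ _)]
  exact intervalIntegral.intervalIntegral_pos_of_pos_on
    (((continuous_fallingProd _).sub (continuous_fallingProd _)).intervalIntegrable _ _)
    (fun x hx => sub_pos.2 (fallingProd_succ_lt hx.1 hx.2 m)) one_pos

theorem thieleB_strictAntiOn : StrictAntiOn thieleB (Set.Ici 1) := by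
  have h : StrictAnti fun n => thieleB (n + 1) := strictAnti_nat_of_succ_lt fun n =>
    thieleB_succ_lt (by omega)
  intro m hm n hn hmn
  rw [Set.mem_Ici] at hm hn
  have := h (show m - 1 < n - 1 by omega)
  simpa [Nat.sub_add_cancel hm, Nat.sub_add_cancel hn] using this

theorem thieleB_le {m n : ℕ} (hm : 1 ≤ m) (hmn : m ≤ n) : thieleB n ≤ thieleB m :=
  thieleB_strictAntiOn.antitoneOn hm (hm.trans hmn) hmn

theorem thieleB_zero : thieleB 0 = 0 := by rw [thieleB]

theorem thieleB_one : thieleB 1 = 1 := by simpa using thieleB_recursion le_rfl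

theorem thieleB_le_one (n : ℕ) : thieleB n ≤ 1 := by
  rcases Nat.eq_zero_or_pos n with rfl | hn
  · simp [thieleB_zero]
  · exact (thieleB_le le_rfl hn).trans_eq thieleB_one

theorem thieleB_nonneg (n : ℕ) : 0 ≤ thieleB n := by
  rcases Nat.eq_zero_or_pos n with rfl | hn
  · simp [thieleB_zero]
  · exact (thieleB_pos hn).le


/-! ### Ranks in the order of election -/

section Rank

variable {C : Type*} {R : Finset C} {r : C → ℕ}

/-- Counting the elements from `c` on is a bijection of `R` onto `{1, …, #R}`. -/
theorem sum_card_filter_ge_eq_sum_Icc (hr : Set.InjOn r R) (f : ℕ → ℝ) :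
    ∑ c ∈ R, f (#{d ∈ R | r c ≤ r d}) = ∑ i ∈ Icc 1 #R, f i := by
  have hlt : ∀ c ∈ R, ∀ d ∈ R, r c < r d → #{x ∈ R | r d ≤ r x} < #{x ∈ R | r c ≤ r x} := by
    intro c hc d _ hcd
    refine card_lt_card ⟨fun x hx => ?_, fun h => ?_⟩
    · rw [mem_filter] at hx ⊢
      exact ⟨hx.1, hcd.le.trans hx.2⟩
    · have := (mem_filter.1 (h (mem_filter.2 ⟨hc, le_rfl⟩))).2
      omega
  have hinj : Set.InjOn (fun c => #{d ∈ R | r c ≤ r d}) R := by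
    intro c hc d hd h
    dsimp only at h
    rcases lt_trichotomy (r c) (r d) with h' | h' | h'
    · have := hlt c hc d hd h'
      omega
    · exact hr hc hd h'
    · have := hlt d hd c hc h'
      omega
  have himg : R.image (fun c => #{d ∈ R | r c ≤ r d}) = Icc 1 #R := by
    refine eq_of_subset_of_card_le (fun i hi => ?_) ?_
    · obtain ⟨c, hc, rfl⟩ := mem_image.1 hi
      rw [mem_Icc]
      exact ⟨card_pos.2 ⟨c, mem_filter.2 ⟨hc, le_rfl⟩⟩, card_filter_le _ _⟩
    · rw [card_image_of_injOn hinj, Nat.card_Icc, Nat.add_sub_cancel]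
  rw [← himg, sum_image hinj]

theorem card_filter_ge_add_card_filter_le (hr : Set.InjOn r R) {c : C} (hc : c ∈ R) :
    #{d ∈ R | r c ≤ r d} + #{d ∈ R | r d ≤ r c} = #R + 1 := by
  classical
  rw [← card_union_add_card_inter]
  congr 1
  · congr 1
    ext d
    simp only [mem_union, mem_filter]
    have := le_total (r c) (r d)
    tauto
  · rw [card_eq_one]
    refine ⟨c, ?_⟩
    ext d
    simp only [mem_inter, mem_filter, mem_singleton]
    constructor
    · rintro ⟨⟨hd, h1⟩, _, h2⟩
      exact hr hd hc (le_antisymm h2 h1)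
    · rintro rfl
      exact ⟨⟨hc, le_rfl⟩, hc, le_rfl⟩

end Rank

theorem List.idxOf_le_of_find?_eq_some {C : Type*} [DecidableEq C] {L : List C} {E : Finset C} {c d : C}
    (h : L.find? (fun x => x ∉ E) = some c) (hd : d ∉ E) : L.idxOf c ≤ L.idxOf d := by
  obtain ⟨_, as, bs, rfl, has⟩ := List.find?_eq_some_iff_append.1 h
  have hd' : d ∉ as := fun h' => hd (by simpa using has d h')
  rw [List.idxOf_append, List.idxOf_append, if_neg hd']
  split_ifs with h'
  · exact (List.idxOf_lt_length_iff.2 h').le.trans (Nat.le_add_left _ _)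
  · simp

/-! ### Lower bound for the number of voters -/

namespace OrderedElection

variable {V C : Type*} [Fintype V] [DecidableEq C]

theorem mem_electedBefore {S : ℕ} {e : Fin S → C} {r : Fin S} {c : C} :
    c ∈ electedBefore e r ↔ ∃ s < r, e s = c := by
  simp [electedBefore]

theorem IsThieleOrder.injective {P : OrderedElection V C} {S : ℕ} {e : Fin S → C}
    (h : P.IsThieleOrder e) : Function.Injective e := by
  have key : ∀ r s : Fin S, r < s → e r ≠ e s := fun r s hrs heq =>
    (h s).1 (mem_electedBefore.2 ⟨r, hrs, heq⟩)
  intro r s hrs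
  rcases lt_trichotomy r s with h' | h' | h'
  · exact (key r s h' hrs).elim
  · exact h'
  · exact (key s r h' hrs.symm).elim

/-- The names on a ballot for which it is counted when they are elected get a total of at most
`1` if the candidates are weighted by `b` according to their place in the order of election. -/
theorem sum_thieleB_div_le_one {S : ℕ} {e : Fin S → C} (he : Function.Injective e)
    (L : List C) (A : Finset C) (r : C → Fin S) (hr : ∀ c ∈ A, e (r c) = c) :
    ∑ c ∈ A, (if L.find? (fun d => d ∉ electedBefore e (r c)) = some c then
      thieleB (#{d ∈ A | (r c : ℕ) ≤ r d}) * (1 / ((L.idxOf c : ℝ) + 1)) else 0) ≤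
      if ∃ c ∈ A, c ∈ L then 1 else 0 := by
  rw [← sum_filter]
  set R := {c ∈ A | L.find? (fun d => d ∉ electedBefore e (r c)) = some c} with hR
  have hRA : ∀ c ∈ R, c ∈ A := fun c hc => (mem_filter.1 hc).1
  have hfind : ∀ c ∈ R, L.find? (fun d => d ∉ electedBefore e (r c)) = some c :=
    fun c hc => (mem_filter.1 hc).2
  have hinj : Set.InjOn (fun c => (r c : ℕ)) R := by
    intro c hc d hd h
    rw [← hr c (hRA c hc), ← hr d (hRA d hd), Fin.ext h]
  by_cases hne : R.Nonempty
  · obtain ⟨c₀, hc₀⟩ := hne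
    rw [if_pos ⟨c₀, hRA c₀ hc₀, List.mem_of_find?_eq_some (hfind c₀ hc₀)⟩]
    have hcard : 1 ≤ #R := card_pos.2 ⟨c₀, hc₀⟩
    refine le_trans ?_ (thieleB_convolution hcard).le
    rw [← sum_card_filter_ge_eq_sum_Icc hinj
      (fun i => thieleB i / ((#R : ℝ) + 1 - (i : ℝ)))]
    refine sum_le_sum fun c hc => ?_
    have hsum := card_filter_ge_add_card_filter_le hinj hc
    have hge : 1 ≤ #{d ∈ R | (r c : ℕ) ≤ r d} := card_pos.2 ⟨c, mem_filter.2 ⟨hc, le_rfl⟩⟩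
    have hle : 1 ≤ #{d ∈ R | (r d : ℕ) ≤ r c} := card_pos.2 ⟨c, mem_filter.2 ⟨hc, le_rfl⟩⟩
    -- When the ballot counts for such a `d`, `c` is not yet elected, so `d` is not below `c` on the
    -- ballot; the positions are distinct.
    have hidx : #{d ∈ R | (r d : ℕ) ≤ r c} ≤ L.idxOf c + 1 := by
      rw [← card_range (L.idxOf c + 1)]
      refine card_le_card_of_injOn (fun d => L.idxOf d) (fun d hd => ?_) ?_
      · obtain ⟨hdR, hdc⟩ := mem_filter.1 hd
        have hnot : c ∉ electedBefore e (r d) := by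
          rw [mem_electedBefore]
          rintro ⟨s, hs, hsc⟩
          rw [he (hsc.trans (hr c (hRA c hc)).symm)] at hs
          exact absurd hdc (not_le.2 hs)
        have := List.idxOf_le_of_find?_eq_some (hfind d hdR) hnot
        rw [coe_range, Set.mem_Iio]
        exact Nat.lt_succ_iff.2 this
      · intro d hd d' _ h
        exact (List.idxOf_inj (List.mem_of_find?_eq_some
          (hfind d (mem_filter.1 hd).1))).1 h
    -- Ranks within `A` are at least those within `R`, and `b` decreases.
    have hb : thieleB (#{d ∈ A | (r c : ℕ) ≤ r d}) ≤ thieleB (#{d ∈ R | (r c : ℕ) ≤ r d}) :=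
      thieleB_le hge (card_le_card (filter_subset_filter _ (filter_subset _ _)))
    have hcast : (#R : ℝ) + 1 - (#{d ∈ R | (r c : ℕ) ≤ r d} : ℝ) =
        (#{d ∈ R | (r d : ℕ) ≤ r c} : ℝ) := by
      rw [sub_eq_iff_eq_add']
      exact_mod_cast hsum.symm
    rw [hcast, mul_one_div]
    have h1 : (0 : ℝ) < #{d ∈ R | (r d : ℕ) ≤ r c} := by exact_mod_cast hle
    have h2 : (#{d ∈ R | (r d : ℕ) ≤ r c} : ℝ) ≤ (L.idxOf c : ℝ) + 1 := by exact_mod_cast hidx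
    exact div_le_div₀ (thieleB_nonneg _) hb h1 h2
  · rw [not_nonempty_iff_eq_empty.1 hne, sum_empty]
    split_ifs <;> norm_num

/-- Weak duality: weight the scores by the dual prices and exchange the sums over candidates and
voters. -/
theorem sum_thieleB_mul_le_votersFor (P : OrderedElection V C) {S : ℕ} {e : Fin S → C}
    (A : Finset C) {t : ℝ} (hP : P.IsThieleOrder e)
    (hA : ∀ c ∈ A, P.ElectedWithScoreAtLeast e t c) :
    (∑ i ∈ Icc 1 #A, thieleB i) * t ≤ P.votersFor A := by
  rcases A.eq_empty_or_nonempty with rfl | ⟨c₀, hc₀⟩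
  · simp [votersFor]
  have : Nonempty (Fin S) := ⟨(hA c₀ hc₀).choose⟩
  have hA' : ∀ c, ∃ r : Fin S, c ∈ A → e r = c ∧ t ≤ P.score (electedBefore e r) c := by
    intro c
    by_cases hc : c ∈ A
    · obtain ⟨r, hr⟩ := hA c hc
      exact ⟨r, fun _ => hr⟩
    · exact ⟨Classical.arbitrary _, fun h => absurd h hc⟩
  choose r hr using hA'
  have hinj : Set.InjOn (fun c => (r c : ℕ)) A := by
    intro c hc d hd h
    rw [← (hr c hc).1, ← (hr d hd).1, Fin.ext h]
  rw [← sum_card_filter_ge_eq_sum_Icc hinj thieleB, sum_mul]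
  calc ∑ c ∈ A, thieleB (#{d ∈ A | (r c : ℕ) ≤ r d}) * t
      ≤ ∑ c ∈ A, thieleB (#{d ∈ A | (r c : ℕ) ≤ r d}) * P.score (electedBefore e (r c)) c :=
        sum_le_sum fun c hc => mul_le_mul_of_nonneg_left (hr c hc).2 (thieleB_nonneg _)
    _ = ∑ v, P.weight v * ∑ c ∈ A,
          (if (P.ballot v).find? (fun d => d ∉ electedBefore e (r c)) = some c then
            thieleB (#{d ∈ A | (r c : ℕ) ≤ r d}) * (1 / (((P.ballot v).idxOf c : ℝ) + 1))
          else 0) := by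
        simp only [score, mul_sum]
        rw [sum_comm]
        refine sum_congr rfl fun v _ => sum_congr rfl fun c _ => ?_
        split_ifs
        · ring
        · simp
    _ ≤ ∑ v, P.weight v * (if ∃ c ∈ A, c ∈ P.ballot v then 1 else 0) :=
        sum_le_sum fun v _ => mul_le_mul_of_nonneg_left
          (sum_thieleB_div_le_one hP.injective (P.ballot v) A r fun c hc => (hr c hc).1)
          (P.weight_pos v).le
    _ = P.votersFor A := by
        simp only [votersFor, sum_filter, mul_ite, mul_one, mul_zero]

theorem votersFor_le_totalVotes (P : OrderedElection V C) (A : Finset C) :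
    P.votersFor A ≤ P.totalVotes :=
  sum_le_sum_of_subset_of_nonneg (filter_subset _ _) fun v _ _ => (P.weight_pos v).le

/-! ### The extremal election -/

/-- The election in which the candidates `v, v + 1, …, n - 1` are on ballot number `v`, which has
weight `b (v + 1)`. -/
noncomputable def extremal (n : ℕ) : OrderedElection (Fin n) (Fin n) where
  ballot v := (List.finRange n).drop v
  nodup v := (List.nodup_finRange n).sublist (List.drop_sublist _ _)
  weight v := thieleB (v + 1)
  weight_pos v := thieleB_pos (by omega)

theorem mem_electedBefore_id {n : ℕ} {r d : Fin n} : d ∈ electedBefore id r ↔ d < r := by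
  simp [electedBefore]

theorem find?_extremal_ballot {n : ℕ} (r v : Fin n) :
    ((extremal n).ballot v).find? (fun d => d ∉ electedBefore id r) = some (max v r) := by
  rw [List.find?_eq_some_iff_getElem]
  refine ⟨by simp [mem_electedBefore_id], (max v r : Fin n) - (v : ℕ), ?_, ?_, ?_⟩
  · simp only [extremal, List.length_drop, List.length_finRange]
    omega
  · ext
    have : (v : ℕ) ≤ (max v r : Fin n) := le_max_left v r
    simp only [extremal, List.getElem_drop, List.getElem_finRange, Fin.val_cast]
    omega
  · intro j hj
    simp only [extremal, List.getElem_drop, List.getElem_finRange, mem_electedBefore_id]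
    simp only [decide_not, Bool.not_not, decide_eq_true_eq, Fin.lt_def, Fin.val_cast]
    rcases le_total v r with h | h
    · rw [max_eq_right h] at hj
      omega
    · rw [max_eq_left h] at hj
      omega

theorem idxOf_extremal_ballot {n : ℕ} {c v : Fin n} (h : v ≤ c) :
    ((extremal n).ballot v).idxOf c = c - v := by
  have hlen : (c - v : ℕ) < ((extremal n).ballot v).length := by
    simp only [extremal, List.length_drop, List.length_finRange]
    omega
  have hget : ((extremal n).ballot v)[(c - v : ℕ)] = c := by
    ext
    have : (v : ℕ) ≤ c := h
    simp only [extremal, List.getElem_drop, List.getElem_finRange, Fin.val_cast]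
    omega
  conv_lhs => rw [← hget]
  exact ((extremal n).nodup v).idxOf_getElem _ hlen

/-- Exactly the ballots `v ≤ r` count for `r`, at place `r - v + 1`, so the score is the
convolution. -/
theorem score_extremal_self {n : ℕ} (r : Fin n) :
    (extremal n).score (electedBefore id r) r = 1 := by
  have h : ∀ v : Fin n, (if ((extremal n).ballot v).find? (fun d => d ∉ electedBefore id r) = some r
      then (extremal n).weight v * (1 / ((((extremal n).ballot v).idxOf r : ℝ) + 1)) else 0) =
      if (v : ℕ) < r + 1 then
        thieleB (v + 1) / (((r + 1 : ℕ) : ℝ) + 1 - ((v + 1 : ℕ) : ℝ)) else 0 := by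
    intro v
    rw [find?_extremal_ballot]
    by_cases hv : v ≤ r
    · have hv' : (v : ℕ) ≤ r := hv
      rw [if_pos (by rw [max_eq_right hv]), if_pos (by omega), idxOf_extremal_ballot hv,
        Nat.cast_sub hv', mul_one_div]
      simp only [extremal]
      congr 1
      push_cast
      ring
    · rw [if_neg, if_neg]
      · rw [Fin.le_def] at hv
        omega
      · rw [max_eq_left (not_le.1 hv).le, Option.some.injEq]
        rintro rfl
        exact hv le_rfl
  rw [score, sum_congr rfl fun v _ => h v, ← Finset.sum_range (fun v => if v < (r : ℕ) + 1 then
        thieleB (v + 1) / (((r + 1 : ℕ) : ℝ) + 1 - ((v + 1 : ℕ) : ℝ)) else 0), ← sum_filter]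
  refine Eq.trans ?_ (thieleB_convolution (show 1 ≤ (r : ℕ) + 1 by omega))
  rw [sum_Icc_one_eq_sum_range]
  refine sum_congr ?_ fun _ _ => rfl
  ext i
  simp only [mem_filter, mem_range]
  omega

/-- Only ballot `c` counts for `c`, as its first name, so the score is `b_{c+1}`. -/
theorem score_extremal_of_lt {n : ℕ} {r c : Fin n} (h : r < c) :
    (extremal n).score (electedBefore id r) c ≤ 1 := by
  rw [score, Finset.sum_eq_single c]
  · rw [find?_extremal_ballot, max_eq_left h.le, if_pos rfl, idxOf_extremal_ballot le_rfl]
    simpa [extremal] using thieleB_le_one _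
  · intro v _ hv
    rw [find?_extremal_ballot, if_neg]
    rw [Option.some.injEq]
    rcases max_choice v r with h' | h' <;> rw [h']
    · exact hv
    · exact h.ne
  · simp

theorem isThieleOrder_extremal (n : ℕ) : (extremal n).IsThieleOrder (id : Fin n → Fin n) := by
  refine fun r => ⟨by simp [mem_electedBefore_id], fun c hc => ?_⟩
  rw [mem_electedBefore_id, not_lt] at hc
  rw [id_eq, score_extremal_self]
  rcases hc.eq_or_lt with rfl | h
  · exact (score_extremal_self _).le
  · exact score_extremal_of_lt h

theorem totalVotes_extremal (n : ℕ) : (extremal n).totalVotes = ∑ i ∈ Icc 1 n, thieleB i := by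
  rw [sum_Icc_one_eq_sum_range, Finset.sum_range]
  rfl

end OrderedElection

open OrderedElection in
theorem isLeast_thieleVoteTotals (n : ℕ) :
    IsLeast (thieleVoteTotals n) (∑ i ∈ Icc 1 n, thieleB i) := by
  refine ⟨⟨n, extremal n, n, id, isThieleOrder_extremal n,
    fun c => ⟨c, rfl, (score_extremal_self c).ge⟩, (totalVotes_extremal n).symm⟩, ?_⟩
  rintro x ⟨N, P, S, e, hP, hc, rfl⟩
  have h := P.sum_thieleB_mul_le_votersFor univ hP fun c _ => hc c
  rw [card_univ, Fintype.card_fin, mul_one] at h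
  exact h.trans (P.votersFor_le_totalVotes _)

theorem thieleA_eq_sum (n : ℕ) : thieleA n = ∑ i ∈ Icc 1 n, thieleB i :=
  (isLeast_thieleVoteTotals n).csInf_eq


/-! ### Asymptotics -/

/-- The polynomial `∏_{k=2}^{n+1} (1 - x / k)`. -/
noncomputable def tailProd (n : ℕ) (x : ℝ) : ℝ := ∏ k ∈ range n, (1 - x / ((k : ℝ) + 2))

theorem tailProd_succ (n : ℕ) (x : ℝ) :
    tailProd (n + 1) x = tailProd n x * (1 - x / ((n : ℝ) + 2)) := by
  simp [tailProd, prod_range_succ]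

theorem continuous_tailProd (n : ℕ) : Continuous (tailProd n) := by
  unfold tailProd
  fun_prop

theorem fallingProd_succ_eq (n : ℕ) (x : ℝ) : fallingProd (n + 1) x = (1 - x) * tailProd n x := by
  rw [fallingProd, prod_range_succ', tailProd, mul_comm]
  congr 1
  · simp
  · refine prod_congr rfl fun k _ => ?_
    push_cast
    ring

theorem sum_fallingProd (n : ℕ) (x : ℝ) :
    ∑ i ∈ range (n + 1), fallingProd i x = ((n : ℝ) + 1) * tailProd n x := by
  induction n with
  | zero => simp [fallingProd, tailProd]
  | succ n ih =>
    rw [sum_range_succ, ih, fallingProd_succ_eq, tailProd_succ]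
    have : (n : ℝ) + 2 ≠ 0 := by positivity
    push_cast
    field_simp
    ring

/-- Bernoulli gives `(1 - 1/k)^x ≤ 1 - x/k`, and the product of the left sides telescopes to
`(n+1)^(-x)`. -/
theorem exp_neg_mul_log_le_tailProd {x : ℝ} (hx0 : 0 ≤ x) (hx1 : x ≤ 1) (n : ℕ) :
    Real.exp (-(Real.log ((n : ℝ) + 1) * x)) ≤ tailProd n x := by
  induction n with
  | zero => simp [tailProd]
  | succ n ih =>
    have h1 : (0 : ℝ) < (n : ℝ) + 1 := by positivity
    have h2 : (0 : ℝ) < (n : ℝ) + 2 := by positivity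
    have h3 : 1 + -(1 / ((n : ℝ) + 2)) = ((n : ℝ) + 1) / ((n : ℝ) + 2) := by
      field_simp
      ring
    have h := rpow_one_add_le_one_add_mul_self (s := -(1 / ((n : ℝ) + 2)))
      (by rw [neg_le_neg_iff, div_le_one h2]; linarith [n.cast_nonneg (α := ℝ)]) hx0 hx1
    rw [h3, Real.rpow_def_of_pos (div_pos h1 h2), Real.log_div h1.ne' h2.ne'] at h
    rw [tailProd_succ]
    push_cast
    calc Real.exp (-(Real.log ((n : ℝ) + 1 + 1) * x))
        = Real.exp (-(Real.log ((n : ℝ) + 1) * x)) *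
          Real.exp ((Real.log ((n : ℝ) + 1) - Real.log ((n : ℝ) + 2)) * x) := by
          rw [← Real.exp_add, show (n : ℝ) + 1 + 1 = n + 2 by ring]
          ring_nf
      _ ≤ tailProd n x * (1 - x / ((n : ℝ) + 2)) :=
          mul_le_mul ih (h.trans_eq (by ring)) (Real.exp_pos _).le ((Real.exp_pos _).le.trans ih)

theorem tailProd_le_exp_neg_mul_log {x : ℝ} (hx0 : 0 ≤ x) (hx1 : x ≤ 1) (n : ℕ) :
    tailProd n x ≤ Real.exp (-((Real.log ((n : ℝ) + 2) - Real.log 2) * x)) := by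
  induction n with
  | zero => simp [tailProd]
  | succ n ih =>
    have h2 : (0 : ℝ) < (n : ℝ) + 2 := by positivity
    have h3 : (0 : ℝ) < (n : ℝ) + 3 := by positivity
    have hlog : Real.log ((n : ℝ) + 3) - Real.log ((n : ℝ) + 2) ≤ 1 / ((n : ℝ) + 2) := by
      rw [← Real.log_div h3.ne' h2.ne']
      refine (Real.log_le_sub_one_of_pos (div_pos h3 h2)).trans_eq ?_
      field_simp
      ring
    have hfac : 1 - x / ((n : ℝ) + 2) ≤
        Real.exp (-((Real.log ((n : ℝ) + 3) - Real.log ((n : ℝ) + 2)) * x)) := by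
      refine (Real.one_sub_le_exp_neg _).trans (Real.exp_le_exp.2 (neg_le_neg ?_))
      exact (mul_le_mul_of_nonneg_right hlog hx0).trans_eq (by ring)
    have hnn : 0 ≤ 1 - x / ((n : ℝ) + 2) := by
      rw [sub_nonneg, div_le_one h2]
      linarith [n.cast_nonneg (α := ℝ)]
    rw [tailProd_succ]
    push_cast
    calc tailProd n x * (1 - x / ((n : ℝ) + 2))
        ≤ Real.exp (-((Real.log ((n : ℝ) + 2) - Real.log 2) * x)) *
          Real.exp (-((Real.log ((n : ℝ) + 3) - Real.log ((n : ℝ) + 2)) * x)) :=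
          mul_le_mul ih hfac hnn (Real.exp_pos _).le
      _ = Real.exp (-((Real.log ((n : ℝ) + 1 + 2) - Real.log 2) * x)) := by
          rw [← Real.exp_add, show (n : ℝ) + 1 + 2 = n + 3 by ring]
          ring_nf

theorem hasDerivAt_exp_neg_mul (c x : ℝ) :
    HasDerivAt (fun y => Real.exp (-(c * y))) (-c * Real.exp (-(c * x))) x := by
  have h := (((hasDerivAt_id x).const_mul c).neg).exp
  simpa [mul_comm] using h

theorem integral_exp_neg_mul_le {c : ℝ} (hc : 0 < c) :
    ∫ x in (0 : ℝ)..1, Real.exp (-(c * x)) ≤ 1 / c := by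
  have h := intervalIntegral.integral_eq_sub_of_hasDerivAt (a := (0 : ℝ)) (b := 1)
    (f := fun y => -(Real.exp (-(c * y)) / c)) (f' := fun x => Real.exp (-(c * x)))
    (fun x _ => ((hasDerivAt_exp_neg_mul c x).div_const c).neg.congr_deriv (by field_simp))
    (Continuous.intervalIntegrable (by fun_prop) _ _)
  have h2 : 0 < Real.exp (-c) / c := by positivity
  rw [h]
  simp only [mul_one, mul_zero, neg_zero, Real.exp_zero]
  linarith

theorem le_integral_one_sub_mul_exp_neg_mul {c : ℝ} (hc : 0 < c) :
    1 / c - 1 / c ^ 2 ≤ ∫ x in (0 : ℝ)..1, (1 - x) * Real.exp (-(c * x)) := by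
  have h := intervalIntegral.integral_eq_sub_of_hasDerivAt (a := (0 : ℝ)) (b := 1)
    (f := fun y => Real.exp (-(c * y)) * ((y - 1) / c + 1 / c ^ 2))
    (f' := fun x => (1 - x) * Real.exp (-(c * x)))
    (fun x _ => ((hasDerivAt_exp_neg_mul c x).mul
      ((((hasDerivAt_id x).sub_const 1).div_const c).add_const (1 / c ^ 2))).congr_deriv (by
        simp only [id_eq]
        field_simp
        ring))
    (Continuous.intervalIntegrable (by fun_prop) _ _)
  have h2 : 0 < Real.exp (-c) * (1 / c ^ 2) := by positivity
  rw [h]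
  simp only [mul_one, mul_zero, neg_zero, Real.exp_zero, sub_self, zero_div, zero_add, one_mul,
    zero_sub, neg_div]
  linarith

theorem thieleA_succ_eq_integral (n : ℕ) :
    thieleA (n + 1) = ((n : ℝ) + 1) * ∫ x in (0 : ℝ)..1, tailProd n x := by
  rw [thieleA_eq_sum, sum_Icc_one_eq_sum_range]
  simp only [thieleB_succ_eq_integral]
  rw [← intervalIntegral.integral_finsetSum fun i _ =>
    (continuous_fallingProd i).intervalIntegrable _ _]
  simp only [sum_fallingProd, intervalIntegral.integral_const_mul]

theorem thieleA_div_le {n : ℕ} (hn : 3 ≤ n) :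
    thieleA n / n ≤ 1 / (Real.log n - Real.log 2) := by
  obtain ⟨m, rfl⟩ : ∃ m, n = m + 1 := ⟨n - 1, by omega⟩
  have hm : (2 : ℝ) ≤ m := by exact_mod_cast (by omega : 2 ≤ m)
  have hpos : 0 < Real.log ((m : ℝ) + 1) - Real.log 2 :=
    sub_pos.2 (Real.log_lt_log two_pos (by linarith))
  have hle : Real.log ((m : ℝ) + 1) - Real.log 2 ≤ Real.log ((m : ℝ) + 2) - Real.log 2 :=
    sub_le_sub_right (Real.log_le_log (by linarith) (by linarith)) _
  rw [thieleA_succ_eq_integral]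
  push_cast
  rw [mul_div_cancel_left₀ _ (by positivity)]
  calc ∫ x in (0 : ℝ)..1, tailProd m x
      ≤ ∫ x in (0 : ℝ)..1, Real.exp (-((Real.log ((m : ℝ) + 2) - Real.log 2) * x)) :=
        intervalIntegral.integral_mono_on zero_le_one
          ((continuous_tailProd m).intervalIntegrable _ _)
          (Continuous.intervalIntegrable (by fun_prop) _ _)
          fun x hx => tailProd_le_exp_neg_mul_log hx.1 hx.2 m
    _ ≤ 1 / (Real.log ((m : ℝ) + 2) - Real.log 2) := integral_exp_neg_mul_le (hpos.trans_le hle)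
    _ ≤ 1 / (Real.log ((m : ℝ) + 1) - Real.log 2) := one_div_le_one_div_of_le hpos hle

theorem le_thieleB {n : ℕ} (hn : 2 ≤ n) :
    1 / Real.log n - 1 / Real.log n ^ 2 ≤ thieleB n := by
  obtain ⟨m, rfl⟩ : ∃ m, n = m + 1 + 1 := ⟨n - 2, by omega⟩
  refine (le_integral_one_sub_mul_exp_neg_mul
    (Real.log_pos (by exact_mod_cast (by omega : 1 < m + 1 + 1)))).trans ?_
  rw [thieleB_succ_eq_integral]
  refine intervalIntegral.integral_mono_on zero_le_one
    (Continuous.intervalIntegrable (by fun_prop) _ _)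
    ((continuous_fallingProd _).intervalIntegrable _ _) fun x hx => ?_
  rw [fallingProd_succ_eq]
  refine mul_le_mul_of_nonneg_left (le_trans ?_ (exp_neg_mul_log_le_tailProd hx.1 hx.2 m))
    (sub_nonneg.2 hx.2)
  rw [Real.exp_le_exp, neg_le_neg_iff]
  refine mul_le_mul_of_nonneg_right (Real.log_le_log (by positivity) ?_) hx.1
  push_cast
  linarith

/-- The smallest of `b_1, …, b_n` is at most their mean. -/
theorem thieleB_le_thieleA_div {n : ℕ} (hn : 1 ≤ n) : thieleB n ≤ thieleA n / n := by
  rw [le_div_iff₀ (by exact_mod_cast hn), thieleA_eq_sum, mul_comm]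
  have h := card_nsmul_le_sum (Icc 1 n) thieleB (thieleB n) fun i hi =>
    thieleB_le (mem_Icc.1 hi).1 (mem_Icc.1 hi).2
  simpa using h

open Filter Topology

theorem tendsto_log_natCast_atTop : Tendsto (fun n : ℕ => Real.log n) atTop atTop :=
  Real.tendsto_log_atTop.comp tendsto_natCast_atTop_atTop

theorem tendsto_mul_log_of_bounds {u : ℕ → ℝ}
    (hl : ∀ᶠ n : ℕ in atTop, 1 / Real.log n - 1 / Real.log n ^ 2 ≤ u n)
    (hu : ∀ᶠ n : ℕ in atTop, u n ≤ 1 / (Real.log n - Real.log 2)) :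
    Tendsto (fun n : ℕ => u n * Real.log n) atTop (𝓝 1) := by
  have h0 : Tendsto (fun n : ℕ => (Real.log n)⁻¹) atTop (𝓝 0) :=
    tendsto_inv_atTop_zero.comp tendsto_log_natCast_atTop
  have h1 : Tendsto (fun n : ℕ => 1 - (Real.log n)⁻¹) atTop (𝓝 1) := by
    simpa using h0.const_sub 1
  have h2 : Tendsto (fun n : ℕ => (1 - Real.log 2 * (Real.log n)⁻¹)⁻¹) atTop (𝓝 1) := by
    simpa using ((h0.const_mul (Real.log 2)).const_sub 1).inv₀ (by simp)
  refine tendsto_of_tendsto_of_tendsto_of_le_of_le' h1 h2 ?_ ?_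
  · filter_upwards [hl, tendsto_log_natCast_atTop.eventually_gt_atTop 0] with n hn hpos
    refine le_trans (le_of_eq ?_) (mul_le_mul_of_nonneg_right hn hpos.le)
    field_simp
  · filter_upwards [hu, tendsto_log_natCast_atTop.eventually_gt_atTop (Real.log 2)] with n hn h
    have hpos : 0 < Real.log n := (Real.log_pos one_lt_two).trans h
    refine (mul_le_mul_of_nonneg_right hn hpos.le).trans_eq ?_
    have : Real.log n - Real.log 2 ≠ 0 := (sub_pos.2 h).ne'
    rw [show 1 - Real.log 2 * (Real.log n)⁻¹ = (Real.log n - Real.log 2) / Real.log n by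
      field_simp, inv_div, one_div_mul_eq_div]

theorem thieleB_isEquivalent :
    Asymptotics.IsEquivalent atTop thieleB (fun n : ℕ => 1 / Real.log n) := by
  have hne : ∀ᶠ n : ℕ in atTop, 1 / Real.log n ≠ 0 := by
    filter_upwards [tendsto_log_natCast_atTop.eventually_gt_atTop 0] with n hn
    positivity
  rw [Asymptotics.isEquivalent_iff_tendsto_one hne]
  refine (tendsto_mul_log_of_bounds (u := thieleB) ?_ ?_).congr fun n => ?_
  · filter_upwards [eventually_ge_atTop 2] with n hn using le_thieleB hn
  · filter_upwards [eventually_ge_atTop 3] with n hn using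
      (thieleB_le_thieleA_div (by omega)).trans (thieleA_div_le hn)
  · simp [div_eq_mul_inv]

theorem thieleA_isEquivalent :
    Asymptotics.IsEquivalent atTop thieleA (fun n : ℕ => (n : ℝ) / Real.log n) := by
  have hne : ∀ᶠ n : ℕ in atTop, (n : ℝ) / Real.log n ≠ 0 := by
    filter_upwards [tendsto_log_natCast_atTop.eventually_gt_atTop 0, eventually_gt_atTop 0]
      with n hn hn'
    positivity
  rw [Asymptotics.isEquivalent_iff_tendsto_one hne]
  refine (tendsto_mul_log_of_bounds (u := fun n => thieleA n / n) ?_ ?_).congr fun n => ?_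
  · filter_upwards [eventually_ge_atTop 2] with n hn using
      (le_thieleB hn).trans (thieleB_le_thieleA_div (by omega))
  · filter_upwards [eventually_ge_atTop 3] with n hn using thieleA_div_le hn
  · simp only [Pi.div_apply]
    rw [div_div_eq_mul_div, div_mul_eq_mul_div]


/-! ### Generating functions -/

theorem hasFPowerSeriesOnBall_ofScalars_of_hasSum {c : ℕ → ℂ} {f : ℂ → ℂ}
    (h : ∀ z : ℂ, ‖z‖ < 1 → HasSum (fun n => c n * z ^ n) (f z)) :
    HasFPowerSeriesOnBall f (FormalMultilinearSeries.ofScalars ℂ c) 0 1 where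
  r_le := by
    refine ENNReal.le_of_forall_nnreal_lt fun r hr => ?_
    have hr' : ‖((r : ℝ) : ℂ)‖ < 1 := by
      rw [Complex.norm_real, Real.norm_of_nonneg r.coe_nonneg]
      exact_mod_cast hr
    refine FormalMultilinearSeries.le_radius_of_summable _ ?_
    refine (h _ hr').summable.norm.congr fun n => ?_
    rw [norm_mul, norm_pow, Complex.norm_real, Real.norm_of_nonneg r.coe_nonneg,
      FormalMultilinearSeries.ofScalars_norm]
  r_pos := one_pos
  hasSum := by
    intro y hy
    have hy' : ‖y‖ < 1 := by
      rw [mem_eball_zero_iff] at hy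
      simpa [← ofReal_norm, ENNReal.ofReal_lt_one] using hy
    simpa [FormalMultilinearSeries.ofScalars_apply_eq, zero_add, mul_comm] using h y hy'

theorem summable_norm_thieleB_mul_pow {z : ℂ} (hz : ‖z‖ < 1) :
    Summable fun n => ‖(thieleB n : ℂ) * z ^ n‖ := by
  refine (summable_geometric_of_lt_one (norm_nonneg z) hz).of_nonneg_of_le
    (fun n => norm_nonneg _) fun n => ?_
  rw [norm_mul, norm_pow, Complex.norm_real, Real.norm_of_nonneg (thieleB_nonneg n)]
  exact mul_le_of_le_one_left (by positivity) (thieleB_le_one n)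

theorem sum_range_thieleB_div (n : ℕ) :
    ∑ k ∈ range (n + 1), thieleB k / ((n - k : ℕ) : ℝ) = if 2 ≤ n then 1 else 0 := by
  match n with
  | 0 => simp
  | 1 => simp [sum_range_succ, thieleB_zero]
  | n + 2 =>
    rw [if_pos (by omega), sum_range_succ', sum_range_succ]
    refine Eq.trans ?_ (thieleB_convolution (show 1 ≤ n + 1 by omega))
    rw [sum_Icc_one_eq_sum_range]
    -- The end terms vanish: `b_0 = 0`, and for `k = n` the division by zero gives `0`.
    simp only [thieleB_zero, zero_div, add_zero, Nat.sub_self, Nat.cast_zero, div_zero]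
    refine sum_congr rfl fun k hk => ?_
    rw [Nat.cast_sub (by have := mem_range.1 hk; omega)]
    congr 1
    push_cast
    ring

theorem tsum_thieleB_mul_neg_log {z : ℂ} (hz : ‖z‖ < 1) :
    (∑' n, (thieleB n : ℂ) * z ^ n) * -Complex.log (1 - z) = z ^ 2 / (1 - z) := by
  have hlog := Complex.hasSum_taylorSeries_neg_log hz
  have h := hasSum_sum_range_mul_of_summable_norm (summable_norm_thieleB_mul_pow hz)
    hlog.summable.norm
  rw [hlog.tsum_eq] at h
  have hterm : ∀ n : ℕ, ∑ k ∈ range (n + 1),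
      (thieleB k : ℂ) * z ^ k * (z ^ (n - k) / ((n - k : ℕ) : ℂ)) =
        if 2 ≤ n then z ^ n else 0 := by
    intro n
    have h1 : ∀ k ∈ range (n + 1),
        (thieleB k : ℂ) * z ^ k * (z ^ (n - k) / ((n - k : ℕ) : ℂ)) =
          ((thieleB k / ((n - k : ℕ) : ℝ) : ℝ) : ℂ) * z ^ n := by
      intro k hk
      rw [← pow_mul_pow_sub z (Nat.lt_succ_iff.1 (mem_range.1 hk))]
      push_cast
      ring
    rw [sum_congr rfl h1, ← sum_mul, ← Complex.ofReal_sum, sum_range_thieleB_div]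
    split_ifs <;> simp
  simp only [hterm] at h
  have h2 : HasSum (fun n : ℕ => if 2 ≤ n then z ^ n else 0) (z ^ 2 / (1 - z)) := by
    rw [← hasSum_nat_add_iff' 2]
    have h3 := (hasSum_geometric_of_norm_lt_one hz).mul_left (z ^ 2)
    simpa [sum_range_succ, pow_add, mul_comm, div_eq_mul_inv] using h3
  exact h.unique h2

theorem one_sub_ne_zero_of_norm_lt_one {z : ℂ} (hz : ‖z‖ < 1) : 1 - z ≠ 0 := by
  rw [sub_ne_zero]
  rintro rfl
  simp at hz

theorem hasSum_thieleB_mul_pow {z : ℂ} (hz : ‖z‖ < 1) :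
    HasSum (fun n => (thieleB n : ℂ) * z ^ n) (z ^ 2 / (-((1 - z) * Complex.log (1 - z)))) := by
  have hs := (summable_norm_thieleB_mul_pow hz).of_norm.hasSum
  suffices h : z ^ 2 / (-((1 - z) * Complex.log (1 - z))) = ∑' n, (thieleB n : ℂ) * z ^ n by
    rwa [h]
  rcases eq_or_ne z 0 with rfl | h0
  -- At `z = 0` the quotient is `0 / 0 = 0`, which agrees with `b_0`.
  · rw [tsum_eq_single 0 fun n hn => by simp [hn]]
    simp [thieleB_zero]
  · have h := tsum_thieleB_mul_neg_log hz
    have h1 := one_sub_ne_zero_of_norm_lt_one hz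
    -- Otherwise the product identity would give `z^2 / (1 - z) = 0`.
    have hlog : Complex.log (1 - z) ≠ 0 := by
      intro h2
      rw [h2, neg_zero, mul_zero] at h
      exact div_ne_zero (pow_ne_zero 2 h0) h1 h.symm
    rw [div_eq_iff (neg_ne_zero.2 (mul_ne_zero h1 hlog))]
    rw [eq_div_iff h1] at h
    rw [← h]
    ring

/-- Taking partial sums of `b` multiplies its series by `1 / (1 - z)`. -/
theorem hasSum_thieleA_mul_pow {z : ℂ} (hz : ‖z‖ < 1) :
    HasSum (fun n => (thieleA n : ℂ) * z ^ n)
      (z ^ 2 / (-((1 - z) ^ 2 * Complex.log (1 - z)))) := by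
  have hgeom := hasSum_geometric_of_norm_lt_one hz
  have h := hasSum_sum_range_mul_of_summable_norm (summable_norm_thieleB_mul_pow hz)
    hgeom.summable.norm
  rw [hgeom.tsum_eq, (hasSum_thieleB_mul_pow hz).tsum_eq] at h
  have hA : (fun n => (thieleA n : ℂ) * z ^ n) =
      fun n => ∑ k ∈ range (n + 1), (thieleB k : ℂ) * z ^ k * z ^ (n - k) := by
    funext n
    rw [thieleA_eq_sum, sum_Icc_one_eq_sum_range, Complex.ofReal_sum, sum_mul, sum_range_succ']
    simp only [thieleB_zero, Complex.ofReal_zero, zero_mul, add_zero]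
    refine sum_congr rfl fun k hk => ?_
    rw [mul_assoc, pow_mul_pow_sub z (by have := mem_range.1 hk; omega)]
  have hz2 : z ^ 2 / (-((1 - z) ^ 2 * Complex.log (1 - z))) =
      z ^ 2 / (-((1 - z) * Complex.log (1 - z))) * (1 - z)⁻¹ := by
    rw [← div_eq_mul_inv, div_div]
    congr 1
    ring
  rwa [hA, hz2]

end

theorem mainTheorem2 :
    -- the two recursions are equivalent, and `b` satisfies both of them
    (∀ b : ℕ → ℝ,
      (∀ n : ℕ, 1 ≤ n →
        b n = 1 - ∑ i ∈ Finset.Icc 1 (n - 1), b i / ((n : ℝ) + 1 - (i : ℝ))) ↔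
      (∀ n : ℕ, 1 ≤ n → ∑ i ∈ Finset.Icc 1 n, b i / ((n : ℝ) + 1 - (i : ℝ)) = 1)) ∧
    (∀ n : ℕ, 1 ≤ n →
      thieleB n = 1 - ∑ i ∈ Finset.Icc 1 (n - 1), thieleB i / ((n : ℝ) + 1 - (i : ℝ))) ∧
    (∀ n : ℕ, 1 ≤ n → ∑ i ∈ Finset.Icc 1 n, thieleB i / ((n : ℝ) + 1 - (i : ℝ)) = 1) ∧
    -- the numbers `b n`, `n ≥ 1`, lie in `(0, 1]` and are strictly decreasing
    (∀ n : ℕ, 1 ≤ n → 0 < thieleB n ∧ thieleB n ≤ 1) ∧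
    StrictAntiOn thieleB (Set.Ici 1) ∧
    -- the minimum defining `a n` is attained, and it equals `b 1 + ⋯ + b n`
    (∀ n : ℕ, 1 ≤ n → IsLeast (thieleVoteTotals n) (thieleA n)) ∧
    (∀ n : ℕ, 1 ≤ n → thieleA n = ∑ i ∈ Finset.Icc 1 n, thieleB i) ∧
    -- `n` candidates that are all elected with score at least `t` need at least `a n * t` voters
    (∀ (V : Type u) (C : Type v) [Fintype V] [DecidableEq C] (P : OrderedElection V C)
      (S : ℕ) (e : Fin S → C) (n : ℕ) (A : Finset C) (t : ℝ),
      1 ≤ n → A.card = n → 0 ≤ t → P.IsThieleOrder e →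
      (∀ c ∈ A, P.ElectedWithScoreAtLeast e t c) →
      thieleA n * t ≤ P.votersFor A) ∧
    -- the Taylor series at `0` (both functions take their limiting value `0` at `z = 0`)
    HasFPowerSeriesOnBall
      (fun z : ℂ => z ^ 2 / (-((1 - z) ^ 2 * Complex.log (1 - z))))
      (FormalMultilinearSeries.ofScalars ℂ (fun n : ℕ => (thieleA n : ℂ))) 0 1 ∧
    HasFPowerSeriesOnBall
      (fun z : ℂ => z ^ 2 / (-((1 - z) * Complex.log (1 - z))))
      (FormalMultilinearSeries.ofScalars ℂ (fun n : ℕ => (thieleB n : ℂ))) 0 1 ∧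
    -- the asymptotics
    Asymptotics.IsEquivalent Filter.atTop thieleA (fun n : ℕ => (n : ℝ) / Real.log n) ∧
    Asymptotics.IsEquivalent Filter.atTop thieleB (fun n : ℕ => 1 / Real.log n) := by
  refine ⟨fun b => forall₂_congr fun n hn => recursion_iff_convolution b hn,
    fun n hn => thieleB_recursion hn, fun n hn => thieleB_convolution hn,
    fun n hn => ⟨thieleB_pos hn, thieleB_le_one n⟩, thieleB_strictAntiOn,
    fun n _ => ?_, fun n _ => thieleA_eq_sum n, ?_,
    hasFPowerSeriesOnBall_ofScalars_of_hasSum fun z hz => hasSum_thieleA_mul_pow hz,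
    hasFPowerSeriesOnBall_ofScalars_of_hasSum fun z hz => hasSum_thieleB_mul_pow hz,
    thieleA_isEquivalent, thieleB_isEquivalent⟩
  · rw [thieleA_eq_sum]
    exact isLeast_thieleVoteTotals n
  · rintro V C _ _ P S e n A t _ rfl _ hP hA
    rw [thieleA_eq_sum]
    exact P.sum_thieleB_mul_le_votersFor A hP hA
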